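/- For $\beta\in\mathbb C\setminus\{0\}$ consider the discrete equation on the square lattice $$(u_{n,m+1}+1)(u_{n,m}-1)=\beta\,(u_{n+1,m+1}-1)(u_{n+1,m}+1),\qquad n,m\in\mathbb Z, \tag{$E_\beta$}$$ for complex-valued $u_{n,m}$. Let $T_n,T_m$ be the shifts $n\mapsto n+1$, $m\mapsto m+1$. A pair of functions $p_{n,m},q_{n,m}$ that are polynomials in the $u_{n+i,m+j}$, with coefficients possibly depending on $n,m$, is a conservation law of $(E_\beta)$ if $(T_n-1)p_{n,m}=(T_m-1)q_{n,m}$ on all solutions. It is autonomous if $p_{n,m}$ and $q_{n,m}$ do not depend explicitly on $n$ and $m$. It is a conservation law in the $m$-direction of order $k_1-k_2$ if $k_1>k_2$, $p_{n,m}$ is a function of $u_{n,m+k_1},u_{n,m+k_1-1},\dots,u_{n,m+k_2}$ only, and $\dfrac{\partial^2 p_{n,m}}{\partial u_{n,m+k_1}\,\partial u_{n,m+k_2}}\neq 0$ (as a polynomial) for all $n,m$. There are polynomials $\hat P^{(k)}(u_{n,m},\dots,u_{n,m+k})$ and $\hat Q^{(k)}(u_{n,m},\dots,u_{n,m+k-1})$,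 $k\ge 1$, with complex coefficients that depend neither on $n,m$ nor on $\beta$, such that for every $\beta\ne0$ and every $k\ge1$ the functions $$p^{(k)}_{n,m}=\beta^{nk}\hat P^{(k)},\qquad q^{(k)}_{n,m}=\beta^{nk}\hat Q^{(k)}$$ define a conservation law of $(E_\beta)$ in the $m$-direction of order $k$, and such that the following holds for every $N\ge2$ and every primitive $N$-th root of unity $\beta=\beta_N$. For $k\ge 1$ the conservation law $(p^{(k)},q^{(k)})$ is autonomous if and only if $N\mid k$. For every $\kappa\ge1$, the pair $(\hat P^{(\kappa N)},\hat Q^{(\kappa N)})$ is an autonomous conservation law of $(E_{\beta_N})$ in the $m$-direction of order $\kappa N$. In particular, $(E_{\beta_N})$ has autonomous conservation laws in the $m$-direction of infinitely many different orders that are multiples of $N$. -/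

import Mathlib

/-- A field `u` on the square lattice (`u n m` is `u_{n,m}`) that satisfies
`(u_{n,m+1}+1)(u_{n,m}-1) = β (u_{n+1,m+1}-1)(u_{n+1,m}+1)` at every lattice point. -/
def IsLatticeSolution (β : ℂ) (u : ℤ → ℤ → ℂ) : Prop :=
  ∀ n m : ℤ, (u n (m + 1) + 1) * (u n m - 1) = β * ((u (n + 1) (m + 1) - 1) * (u (n + 1) m + 1))

/-- A polynomial lattice function `f_{n,m}`: for each `(n, m)` a polynomial in the variables
`u_{n+i,m+j}`, the variable of index `(i, j)` standing for `u_{n+i,m+j}`.  The dependence of the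
polynomial itself on `(n, m)` is the explicit dependence of `f` on `n` and `m`. -/
abbrev LatticePoly : Type := ℤ → ℤ → MvPolynomial (ℤ × ℤ) ℂ

/-- The value of `f_{n,m}` on the field `u`. -/
noncomputable def LatticePoly.value (f : LatticePoly) (u : ℤ → ℤ → ℂ) (n m : ℤ) : ℂ :=
  MvPolynomial.eval (fun ij : ℤ × ℤ => u (n + ij.1) (m + ij.2)) (f n m)

/-- `f` does not depend explicitly on `n` and `m`. -/
def LatticePoly.IsAutonomous (f : LatticePoly) : Prop :=
  ∀ n m n' m' : ℤ, f n m = f n' m'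

/-- `(T_n - 1) p_{n,m} = (T_m - 1) q_{n,m}` on all solutions of the equation. -/
def IsConservationLaw (β : ℂ) (p q : LatticePoly) : Prop :=
  ∀ u : ℤ → ℤ → ℂ, IsLatticeSolution β u → ∀ n m : ℤ,
    p.value u (n + 1) m - p.value u n m = q.value u n (m + 1) - q.value u n m

/-- The polynomial involves only the variables `u_{n,m+k₂}, …, u_{n,m+k₁}`. -/
def DependsOnColumn (f : MvPolynomial (ℤ × ℤ) ℂ) (k₂ k₁ : ℤ) : Prop :=
  ∀ ij ∈ f.vars, ij.1 = 0 ∧ k₂ ≤ ij.2 ∧ ij.2 ≤ k₁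

/-- A conservation law in the `m`-direction with density `p` has the (positive) order `k`:
`p_{n,m}` is a function of `u_{n,m+k₁}, …, u_{n,m+k₂}` with `k₁ > k₂` and `k₁ - k₂ = k`, and
`∂²p_{n,m} / ∂u_{n,m+k₁} ∂u_{n,m+k₂} ≠ 0` for all `n, m`. -/
def HasOrder (p : LatticePoly) (k : ℕ) : Prop :=
  ∃ k₁ k₂ : ℤ, k₂ < k₁ ∧ k₁ - k₂ = k ∧ ∀ n m : ℤ, DependsOnColumn (p n m) k₂ k₁ ∧
    MvPolynomial.pderiv (0, k₁) (MvPolynomial.pderiv (0, k₂) (p n m)) ≠ 0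

/-- The lattice function `c^{nk} F` with an autonomous polynomial `F`. -/
noncomputable def powMul (c : ℂ) (k : ℕ) (F : MvPolynomial (ℤ × ℤ) ℂ) : LatticePoly :=
  fun n _ => MvPolynomial.C (c ^ (n * (k : ℤ))) * F

/-!
The two Miura maps `w = (u₁ + 1)(u₀ - 1)` and `v = (u₁ - 1)(u₀ + 1)` send a column of the lattice
to fields of the Volterra chain, and the lattice equation says exactly that the image `w_n` of the
column `n` is `β` times the image `v_{n+1}` of the column `n + 1`. The Volterra chain has
conserved densities `ρ_k` that are homogeneous of degree `k`, so
`ρ_k (w_n) = β ^ k ρ_k (v_{n+1})`. If `ρ_k (w) - ρ_k (v)` is a difference `(T_m - 1) Q_k` along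
the column, then `β ^ (n k) ρ_k (v)` is the density of a conservation law with flux
`β ^ (n k) Q_k`, and for a primitive `N`-th root of unity the explicit factors are constant exactly
if `N ∣ k`.

The densities are the coefficients of `X f' / f`, where `f` is the Stieltjes continued fraction
with weights `w`, that is, the solution of `f₀ = 1 + X w₀ f₀ f₁`. The comparison of the two Miura
images is a Darboux transformation: with `h₀ = 1 + 2 X (u₀ + 1) f₀`, the series `f₀ h₁ / h₀`
solves the same recursion with weights `v` (`stieltjes_miura_mul_gauge`). Since `X f' / f` turns
products into sums, the flux is read off from `h` (`density_miura_sub`).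

For the order of the law, the last weight occurs in `ρ_k` only in the term `k v₀ v₁ ⋯ v_{k-1}`
(`density_succ_sub`), and this term alone gives the mixed derivative in the outermost variables
`u_{n,m}` and `u_{n,m+k}` (`pderiv_pderiv_latticeDensity`).
-/

namespace VolterraDensity

open PowerSeries Finset

variable {R S : Type*} [CommRing R] [CommRing S]

/-! ### Coefficients of the Stieltjes fraction -/

/-- Coefficients of the Stieltjes continued fraction `1/(1 - w₀X/(1 - w₁X/(1 - ⋯)))`: the weighted
count of Dyck paths of length `2k`, with weight `w i` for each up-step starting at height `i`. -/
def stieltjesCoeff {R : Type*} [CommRing R] : ℕ → (ℕ → R) → R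
  | 0, _ => 1
  | k + 1, w => w 0 * ∑ i : Fin (k + 1),
      stieltjesCoeff i w * stieltjesCoeff (k - i) (fun j => w (j + 1))

theorem stieltjesCoeff_zero (w : ℕ → R) : stieltjesCoeff 0 w = 1 := by rw [stieltjesCoeff]

theorem stieltjesCoeff_succ (k : ℕ) (w : ℕ → R) :
    stieltjesCoeff (k + 1) w = w 0 * ∑ p ∈ antidiagonal k,
      stieltjesCoeff p.1 w * stieltjesCoeff p.2 (fun j => w (j + 1)) := by
  rw [stieltjesCoeff, Nat.sum_antidiagonal_eq_sum_range_succ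
    (fun i j => stieltjesCoeff i w * stieltjesCoeff j (fun j => w (j + 1))), Finset.sum_range]

theorem map_stieltjesCoeff (φ : R →+* S) (k : ℕ) (w : ℕ → R) :
    φ (stieltjesCoeff k w) = stieltjesCoeff k (fun i => φ (w i)) := by
  induction k using Nat.strong_induction_on generalizing w with
  | _ k ih =>
    cases k with
    | zero => simp [stieltjesCoeff_zero]
    | succ k =>
      rw [stieltjesCoeff_succ, stieltjesCoeff_succ, map_mul, map_sum]
      congr 1
      refine sum_congr rfl fun p hp => ?_
      have := mem_antidiagonal.1 hp
      rw [map_mul, ih _ (by omega), ih _ (by omega)]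

/-- Homogeneity: the `k`-th coefficient has degree `k` in the weights. -/
theorem stieltjesCoeff_mul_left (b : R) (k : ℕ) (w : ℕ → R) :
    stieltjesCoeff k (fun i => b * w i) = b ^ k * stieltjesCoeff k w := by
  induction k using Nat.strong_induction_on generalizing w with
  | _ k ih =>
    cases k with
    | zero => simp [stieltjesCoeff_zero]
    | succ k =>
      rw [stieltjesCoeff_succ, stieltjesCoeff_succ, mul_sum, mul_sum, mul_sum]
      refine sum_congr rfl fun p hp => ?_
      have hp := mem_antidiagonal.1 hp
      rw [ih _ (by omega), ih _ (by omega), ← hp]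
      ring

theorem stieltjesCoeff_mem (A : Subring R) (k : ℕ) (w : ℕ → R) (hw : ∀ i < k, w i ∈ A) :
    stieltjesCoeff k w ∈ A := by
  induction k using Nat.strong_induction_on generalizing w with
  | _ k ih =>
    cases k with
    | zero => simp [stieltjesCoeff_zero]
    | succ k =>
      rw [stieltjesCoeff_succ]
      refine A.mul_mem (hw 0 (by omega)) (A.sum_mem fun p hp => ?_)
      have := mem_antidiagonal.1 hp
      exact A.mul_mem (ih _ (by omega) _ fun i hi => hw i (by omega))
        (ih _ (by omega) _ fun i hi => hw (i + 1) (by omega))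

theorem stieltjesCoeff_congr (k : ℕ) (w w' : ℕ → R) (h : ∀ i < k, w i = w' i) :
    stieltjesCoeff k w = stieltjesCoeff k w' := by
  induction k using Nat.strong_induction_on generalizing w w' with
  | _ k ih =>
    cases k with
    | zero => simp [stieltjesCoeff_zero]
    | succ k =>
      rw [stieltjesCoeff_succ, stieltjesCoeff_succ, h 0 (by omega)]
      congr 1
      refine sum_congr rfl fun p hp => ?_
      have := mem_antidiagonal.1 hp
      rw [ih p.1 (by omega) w w' fun i hi => h i (by omega),
        ih p.2 (by omega) (fun j => w (j + 1)) (fun j => w' (j + 1)) fun i hi => h _ (by omega)]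

/-- The last weight enters the coefficient only through the single monomial `w₀ w₁ ⋯ w_k`, which
comes from the Dyck path that reaches the greatest height. -/
theorem stieltjesCoeff_sub (k : ℕ) (w w' : ℕ → R) (h : ∀ i < k, w i = w' i) :
    stieltjesCoeff (k + 1) w - stieltjesCoeff (k + 1) w' = (∏ i ∈ range k, w i) * (w k - w' k) := by
  induction k generalizing w w' with
  | zero => simp [stieltjesCoeff_succ, stieltjesCoeff_zero]
  | succ k ih =>
    have hs : ∑ p ∈ antidiagonal k, stieltjesCoeff (p.1 + 1) w *
          stieltjesCoeff p.2 (fun j => w (j + 1)) =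
        ∑ p ∈ antidiagonal k, stieltjesCoeff (p.1 + 1) w' *
          stieltjesCoeff p.2 (fun j => w' (j + 1)) := by
      refine sum_congr rfl fun p hp => ?_
      have := mem_antidiagonal.1 hp
      rw [stieltjesCoeff_congr (p.1 + 1) w w' fun i hi => h i (by omega),
        stieltjesCoeff_congr p.2 (fun j => w (j + 1)) (fun j => w' (j + 1))
          fun i hi => h _ (by omega)]
    have ih' := ih (fun j => w (j + 1)) (fun j => w' (j + 1)) fun i hi => h _ (by omega)
    rw [stieltjesCoeff_succ, stieltjesCoeff_succ (k + 1) w', Nat.sum_antidiagonal_succ,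
      Nat.sum_antidiagonal_succ, hs, ← h 0 (by omega), prod_range_succ']
    simp only [stieltjesCoeff_zero]
    linear_combination w 0 * ih'

/-- The Stieltjes continued fraction as a formal power series. -/
noncomputable def stieltjes (w : ℕ → R) : R⟦X⟧ := PowerSeries.mk fun k => stieltjesCoeff k w

theorem stieltjes_eq (w : ℕ → R) :
    stieltjes w = 1 + X * (C (w 0) * (stieltjes w * stieltjes fun j => w (j + 1))) := by
  ext k
  cases k with
  | zero => simp [stieltjes, stieltjesCoeff_zero]
  | succ k =>
    rw [map_add, coeff_succ_X_mul, coeff_C_mul, coeff_mul]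
    simp [stieltjes, stieltjesCoeff_succ, coeff_one]

theorem constantCoeff_stieltjes (w : ℕ → R) : constantCoeff (stieltjes w) = 1 := by
  rw [← coeff_zero_eq_constantCoeff_apply, stieltjes, coeff_mk, stieltjesCoeff_zero]

/-- The Riccati recursion along the lattice has only one formal power series solution. -/
theorem eq_stieltjes_of_riccati (w : ℕ → R) (G : ℕ → R⟦X⟧)
    (hG : ∀ m, G m = 1 + X * (C (w m) * (G m * G (m + 1)))) (m : ℕ) :
    G m = stieltjes fun j => w (m + j) := by
  ext k
  induction k using Nat.strong_induction_on generalizing m with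
  | _ k ih =>
    cases k with
    | zero => rw [hG]; simp [stieltjes, stieltjesCoeff_zero]
    | succ k =>
      rw [hG, map_add, coeff_succ_X_mul, coeff_C_mul, coeff_mul]
      simp only [stieltjes, coeff_mk, stieltjesCoeff_succ, coeff_one, Nat.succ_ne_zero, if_false,
        zero_add, add_zero]
      congr 1
      refine sum_congr rfl fun p hp => ?_
      have := mem_antidiagonal.1 hp
      rw [ih _ (by omega), ih _ (by omega)]
      simp only [stieltjes, coeff_mk]
      congr 2
      funext j
      congr 1
      omega

/-! ### The logarithmic Euler derivative -/

/-- The logarithmic Euler derivative `X f' / f` of a power series with constant coefficient `1`.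
Its `k`-th coefficient is `k` times that of `log f`, so that no denominators are needed. -/
noncomputable def eulerLog (f : R⟦X⟧) : R⟦X⟧ := X * derivative R f * invOfUnit f 1

theorem eulerLog_mul_self {f : R⟦X⟧} (hf : constantCoeff f = 1) :
    eulerLog f * f = X * derivative R f := by
  rw [eulerLog, mul_assoc, invOfUnit_mul f 1 (by simpa using hf), mul_one]

theorem eulerLog_mul {f g : R⟦X⟧} (hf : constantCoeff f = 1) (hg : constantCoeff g = 1) :
    eulerLog (f * g) = eulerLog f + eulerLog g := by
  have hfg : constantCoeff (f * g) = 1 := by rw [map_mul, hf, hg, one_mul]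
  have h : eulerLog (f * g) * (f * g) = (eulerLog f + eulerLog g) * (f * g) := by
    rw [eulerLog_mul_self hfg, Derivation.leibniz, smul_eq_mul, smul_eq_mul]
    linear_combination -g * eulerLog_mul_self hf - f * eulerLog_mul_self hg
  have hu := mul_invOfUnit (f * g) 1 (by simpa using hfg)
  linear_combination invOfUnit (f * g) 1 * h +
    (eulerLog f + eulerLog g - eulerLog (f * g)) * hu

theorem coeff_zero_eulerLog (f : R⟦X⟧) : coeff 0 (eulerLog f) = 0 := by
  simp [eulerLog]

/-- Newton's recursion for the coefficients of the logarithmic derivative. -/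
theorem coeff_succ_eulerLog {f : R⟦X⟧} (hf : constantCoeff f = 1) (k : ℕ) :
    coeff (k + 1) (eulerLog f) = (k + 1) * coeff (k + 1) f -
      ∑ p ∈ antidiagonal k, coeff p.1 (eulerLog f) * coeff (p.2 + 1) f := by
  have h := congrArg (coeff (k + 1)) (eulerLog_mul_self hf)
  rw [coeff_succ_X_mul, coeff_derivative, coeff_mul, Nat.sum_antidiagonal_succ'] at h
  rw [← coeff_zero_eq_constantCoeff_apply] at hf
  simp only [hf] at h
  linear_combination h

theorem coeff_map_eulerLog (φ : R →+* S) {f : R⟦X⟧} {g : S⟦X⟧} (hf : constantCoeff f = 1)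
    (hg : constantCoeff g = 1) (h : ∀ k, φ (coeff k f) = coeff k g) (k : ℕ) :
    φ (coeff k (eulerLog f)) = coeff k (eulerLog g) := by
  induction k using Nat.strong_induction_on with
  | _ k ih =>
    cases k with
    | zero => simp [coeff_zero_eulerLog]
    | succ k =>
      rw [coeff_succ_eulerLog hf, coeff_succ_eulerLog hg, map_sub, map_mul, map_sum, h]
      congr 1
      · simp
      · refine sum_congr rfl fun p hp => ?_
        have := mem_antidiagonal.1 hp
        rw [map_mul, ih _ (by omega), h]

theorem coeff_eulerLog_scale (b : R) {f g : R⟦X⟧} (hf : constantCoeff f = 1)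
    (hg : constantCoeff g = 1) (h : ∀ k, coeff k g = b ^ k * coeff k f) (k : ℕ) :
    coeff k (eulerLog g) = b ^ k * coeff k (eulerLog f) := by
  induction k using Nat.strong_induction_on with
  | _ k ih =>
    cases k with
    | zero => simp [coeff_zero_eulerLog]
    | succ k =>
      rw [coeff_succ_eulerLog hf, coeff_succ_eulerLog hg, mul_sub, mul_sum, h, mul_left_comm]
      congr 1
      refine sum_congr rfl fun p hp => ?_
      have hp := mem_antidiagonal.1 hp
      rw [ih _ (by omega), h, ← hp]
      ring

theorem coeff_eulerLog_mem (A : Subring R) {f : R⟦X⟧} (hf : constantCoeff f = 1) (k : ℕ)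
    (h : ∀ j ≤ k, coeff j f ∈ A) : coeff k (eulerLog f) ∈ A := by
  induction k using Nat.strong_induction_on with
  | _ k ih =>
    cases k with
    | zero => simp [coeff_zero_eulerLog]
    | succ k =>
      rw [coeff_succ_eulerLog hf]
      refine A.sub_mem (A.mul_mem (by exact_mod_cast natCast_mem A (k + 1)) (h _ le_rfl))
        (A.sum_mem fun p hp => ?_)
      have := mem_antidiagonal.1 hp
      exact A.mul_mem (ih _ (by omega) fun j hj => h j (by omega)) (h _ (by omega))

theorem coeff_eulerLog_congr {f g : R⟦X⟧} (hf : constantCoeff f = 1) (hg : constantCoeff g = 1)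
    (k : ℕ) (h : ∀ j ≤ k, coeff j f = coeff j g) :
    coeff k (eulerLog f) = coeff k (eulerLog g) := by
  induction k using Nat.strong_induction_on with
  | _ k ih =>
    cases k with
    | zero => simp [coeff_zero_eulerLog]
    | succ k =>
      rw [coeff_succ_eulerLog hf, coeff_succ_eulerLog hg, h _ le_rfl]
      congr 1
      refine sum_congr rfl fun p hp => ?_
      have := mem_antidiagonal.1 hp
      rw [ih _ (by omega) fun j hj => h j (by omega), h _ (by omega)]

theorem coeff_eulerLog_sub {f g : R⟦X⟧} (hf : constantCoeff f = 1) (hg : constantCoeff g = 1)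
    (k : ℕ) (h : ∀ j < k, coeff j f = coeff j g) :
    coeff k (eulerLog f) - coeff k (eulerLog g) = k * (coeff k f - coeff k g) := by
  cases k with
  | zero => simp [coeff_zero_eulerLog]
  | succ k =>
    have hs : ∑ p ∈ antidiagonal k, coeff p.1 (eulerLog f) * coeff (p.2 + 1) f =
        ∑ p ∈ antidiagonal k, coeff p.1 (eulerLog g) * coeff (p.2 + 1) g := by
      refine sum_congr rfl fun p hp => ?_
      have := mem_antidiagonal.1 hp
      rw [coeff_eulerLog_congr hf hg p.1 fun j hj => h j (by omega)]
      -- the top coefficient is multiplied by the vanishing constant coefficient of `eulerLog`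
      by_cases h0 : p.1 = 0
      · rw [h0, coeff_zero_eulerLog, zero_mul, zero_mul]
      · rw [h _ (by omega)]
    rw [coeff_succ_eulerLog hf, coeff_succ_eulerLog hg, hs]
    push_cast
    ring

/-! ### Densities and fluxes along a column -/

/-- The `k`-th conserved density of the Volterra chain with field `w`. -/
noncomputable def density (k : ℕ) (w : ℕ → R) : R := coeff k (eulerLog (stieltjes w))

/-- The Miura map from the modified Volterra chain to the Volterra chain. -/
def miura (u : ℕ → R) (i : ℕ) : R := (u (i + 1) - 1) * (u i + 1)

/-- The second Miura map, which is conjugate to `miura` under `u ↦ -u`. -/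
def miura' (u : ℕ → R) (i : ℕ) : R := (u (i + 1) + 1) * (u i - 1)

/-- The gauge factor that carries the Stieltjes fraction of one Miura image to that of the other. -/
noncomputable def gauge (u : ℕ → R) : R⟦X⟧ := 1 + X * (C (2 * (u 0 + 1)) * stieltjes (miura' u))

/-- The flux that relates the densities of the two Miura images of a column. -/
noncomputable def flux (k : ℕ) (u : ℕ → R) : R := -coeff k (eulerLog (gauge u))

theorem constantCoeff_gauge (u : ℕ → R) : constantCoeff (gauge u) = 1 := by simp [gauge]

theorem coeff_succ_gauge (u : ℕ → R) (k : ℕ) :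
    coeff (k + 1) (gauge u) = 2 * (u 0 + 1) * stieltjesCoeff k (miura' u) := by
  rw [gauge, map_add, coeff_succ_X_mul, coeff_C_mul]
  simp [stieltjes, coeff_one]

theorem map_density (φ : R →+* S) (k : ℕ) (w : ℕ → R) :
    φ (density k w) = density k fun i => φ (w i) :=
  coeff_map_eulerLog φ (constantCoeff_stieltjes _) (constantCoeff_stieltjes _)
    (fun k => by simp only [stieltjes, coeff_mk, map_stieltjesCoeff]) k

theorem map_flux (φ : R →+* S) (k : ℕ) (u : ℕ → R) :
    φ (flux k u) = flux k fun i => φ (u i) := by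
  rw [flux, flux, map_neg, coeff_map_eulerLog φ (constantCoeff_gauge _) (constantCoeff_gauge _)]
  intro k
  cases k with
  | zero => simp [constantCoeff_gauge]
  | succ k =>
    simp only [coeff_succ_gauge, map_stieltjesCoeff, map_mul, map_add, map_one, map_ofNat]
    congr 2
    funext i
    simp [miura']

theorem density_mul_left (b : R) (k : ℕ) (w : ℕ → R) :
    density k (fun i => b * w i) = b ^ k * density k w :=
  coeff_eulerLog_scale b (constantCoeff_stieltjes _) (constantCoeff_stieltjes _)
    (fun k => by simp only [stieltjes, coeff_mk, stieltjesCoeff_mul_left]) k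

theorem density_mem (A : Subring R) (k : ℕ) (w : ℕ → R) (hw : ∀ i < k, w i ∈ A) :
    density k w ∈ A :=
  coeff_eulerLog_mem A (constantCoeff_stieltjes _) k fun j hj => by
    rw [stieltjes, coeff_mk]
    exact stieltjesCoeff_mem A j w fun i hi => hw i (by omega)

theorem flux_mem (A : Subring R) (k : ℕ) (u : ℕ → R) (hu : ∀ i < k, u i ∈ A) :
    flux k u ∈ A := by
  refine A.neg_mem (coeff_eulerLog_mem A (constantCoeff_gauge _) k fun j hj => ?_)
  cases j with
  | zero => simp [constantCoeff_gauge]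
  | succ j =>
    rw [coeff_succ_gauge]
    refine A.mul_mem (A.mul_mem (by exact_mod_cast natCast_mem A 2)
      (A.add_mem (hu 0 (by omega)) A.one_mem)) (stieltjesCoeff_mem A j _ fun i hi => ?_)
    exact A.mul_mem (A.add_mem (hu _ (by omega)) A.one_mem)
      (A.sub_mem (hu _ (by omega)) A.one_mem)

theorem density_succ_sub (k : ℕ) (w w' : ℕ → R) (h : ∀ i < k, w i = w' i) :
    density (k + 1) w - density (k + 1) w' =
      (k + 1) * ((∏ i ∈ range k, w i) * (w k - w' k)) := by
  rw [density, density, coeff_eulerLog_sub (constantCoeff_stieltjes _) (constantCoeff_stieltjes _)]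
  · simp only [stieltjes, coeff_mk, stieltjesCoeff_sub k w w' h]
    push_cast
    rfl
  · intro j hj
    simp only [stieltjes, coeff_mk]
    exact stieltjesCoeff_congr j w w' fun i hi => h i (by omega)

/-- The Darboux transformation: the Stieltjes fractions of the two Miura images differ by a factor
that is a quotient of the gauge factor and its shift. The candidate for the fraction of `miura u`
given by this formula satisfies the Riccati recursion, hence is that fraction. -/
theorem stieltjes_miura_mul_gauge (u : ℕ → R) :
    stieltjes (miura u) * gauge u =
      stieltjes (miura' u) * gauge (fun j => u (j + 1)) := by
  set f : ℕ → R⟦X⟧ := fun m => stieltjes (miura' fun j => u (m + j)) with hf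
  set h : ℕ → R⟦X⟧ := fun m => gauge fun j => u (m + j) with hh
  have hinv (m : ℕ) : h m * invOfUnit (h m) 1 = 1 :=
    mul_invOfUnit _ _ (by simpa using constantCoeff_gauge _)
  have hric (m : ℕ) : f m = 1 + X * (C ((u (m + 1) + 1) * (u m - 1)) * (f m * f (m + 1))) := by
    have hshift : (fun j => miura' (fun j => u (m + j)) (j + 1)) =
        miura' fun j => u (m + 1 + j) := by
      funext j
      simp only [miura', add_assoc, add_comm 1]
    have h := stieltjes_eq (miura' fun j => u (m + j))
    rwa [hshift] at h
  have hdef (m : ℕ) : h m = 1 + X * (C (2 * (u m + 1)) * f m) := rfl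
  have key (m : ℕ) : f m * h (m + 1) =
      h m + X * (C ((u (m + 1) - 1) * (u m + 1)) * (f m * f (m + 1) * h (m + 2))) := by
    have h0 := hric m
    have h1 := hric (m + 1)
    rw [hdef (m + 2), hdef (m + 1), hdef m]
    simp only [map_mul, map_add, map_sub, map_one, map_ofNat, add_assoc, Nat.reduceAdd] at h0 h1 ⊢
    linear_combination h0 + 2 * X * (C (u m) + 1) * f m * h1
  have hG := eq_stieltjes_of_riccati (miura u) (fun m => f m * h (m + 1) * invOfUnit (h m) 1)
    (fun m => by
      have k := key m
      simp only [miura]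
      linear_combination invOfUnit (h m) 1 * k + hinv m -
        X * C ((u (m + 1) - 1) * (u m + 1)) * f m * f (m + 1) * h (m + 2) *
          invOfUnit (h m) 1 * hinv (m + 1)) 0
  have e0 : f 0 = stieltjes (miura' u) := by simp [hf]
  have e1 : h 0 = gauge u := by simp [hh]
  have e2 : h (0 + 1) = gauge fun j => u (j + 1) := by simp [hh, add_comm]
  simp only [zero_add (M := ℕ)] at hG
  rw [← e0, ← e1, ← e2]
  change _ = stieltjes (miura u) at hG
  rw [← hG]
  linear_combination f 0 * h 1 * hinv 0

/-- The densities of the two Miura images are equivalent up to a difference along the column. -/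
theorem density_miura_sub (k : ℕ) (u : ℕ → R) :
    density k (miura' u) - density k (miura u) = flux k (fun j => u (j + 1)) - flux k u := by
  have h := congrArg (fun f => coeff k (eulerLog f)) (stieltjes_miura_mul_gauge u)
  simp only [eulerLog_mul (constantCoeff_stieltjes _) (constantCoeff_gauge _), map_add] at h
  simp only [density, flux]
  linear_combination -h

/-! ### The hierarchy on the lattice -/

open MvPolynomial (pderiv)

/-- The variables `u_{n,m}, u_{n,m+1}, …` of a column. -/
noncomputable def column (i : ℕ) : MvPolynomial (ℤ × ℤ) ℂ := MvPolynomial.X (0, (i : ℤ))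

/-- The density of the `k`-th law of the hierarchy, without the factor `β ^ (n k)`. -/
noncomputable def latticeDensity (k : ℕ) : MvPolynomial (ℤ × ℤ) ℂ := density k (miura column)

/-- The flux of the `k`-th law of the hierarchy, without the factor `β ^ (n k)`. -/
noncomputable def latticeFlux (k : ℕ) : MvPolynomial (ℤ × ℤ) ℂ := flux k column

/-- The polynomials in `u_{n,m}, …, u_{n,m+k-1}`. -/
noncomputable def columnSubring (k : ℕ) : Subring (MvPolynomial (ℤ × ℤ) ℂ) :=
  (MvPolynomial.supported ℂ {ij : ℤ × ℤ | ij.1 = 0 ∧ 0 ≤ ij.2 ∧ ij.2 < k}).toSubring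

theorem column_mem {i k : ℕ} (h : i < k) : column i ∈ columnSubring k :=
  MvPolynomial.X_mem_supported.2 ⟨rfl, by simp, by simpa using h⟩

theorem miura_column_mem {i k : ℕ} (h : i + 1 < k) : miura column i ∈ columnSubring k :=
  Subring.mul_mem _ (Subring.sub_mem _ (column_mem h) (Subring.one_mem _))
    (Subring.add_mem _ (column_mem (by omega)) (Subring.one_mem _))

theorem dependsOnColumn_of_mem {k : ℕ} {f : MvPolynomial (ℤ × ℤ) ℂ} (hf : f ∈ columnSubring k) :
    DependsOnColumn f 0 ((k : ℤ) - 1) := by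
  intro ij hij
  obtain ⟨h1, h2, h3⟩ := MvPolynomial.mem_supported.1 hf hij
  exact ⟨h1, h2, by omega⟩

theorem pderiv_eq_zero_of_mem {k : ℕ} {f : MvPolynomial (ℤ × ℤ) ℂ} (hf : f ∈ columnSubring k) :
    pderiv (0, (k : ℤ)) f = 0 := by
  refine MvPolynomial.pderiv_eq_zero_of_notMem_vars fun h => ?_
  obtain ⟨-, -, h3⟩ := MvPolynomial.mem_supported.1 hf h
  exact lt_irrefl _ h3

theorem pderiv_comm {σ : Type*} (i j : σ) (f : MvPolynomial σ ℂ) :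
    pderiv i (pderiv j f) = pderiv j (pderiv i f) := by
  classical
  have h : ⁅pderiv (R := ℂ) i, pderiv (R := ℂ) j⁆ = 0 := by
    refine MvPolynomial.derivation_ext fun l => ?_
    rw [Derivation.commutator_apply]
    simp [MvPolynomial.pderiv_X, Pi.single_apply, apply_ite]
  have := DFunLike.congr_fun h f
  rw [Derivation.commutator_apply] at this
  simpa [sub_eq_zero] using this

theorem latticeDensity_dependsOnColumn (k : ℕ) : DependsOnColumn (latticeDensity k) 0 k := by
  have h : latticeDensity k ∈ columnSubring (k + 1) :=
    density_mem _ k _ fun i hi => miura_column_mem (by omega)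
  simpa using dependsOnColumn_of_mem h

theorem latticeFlux_dependsOnColumn (k : ℕ) : DependsOnColumn (latticeFlux k) 0 ((k : ℤ) - 1) :=
  dependsOnColumn_of_mem (flux_mem _ k _ fun _ hi => column_mem hi)

theorem prod_miura (u : ℕ → R) (k : ℕ) :
    ∏ i ∈ range (k + 1), miura u i =
      (u 0 + 1) * (∏ i ∈ range k, (u (i + 1) - 1) * (u (i + 1) + 1)) * (u (k + 1) - 1) := by
  induction k with
  | zero => simp [miura, mul_comm]
  | succ k ih => rw [prod_range_succ, ih, prod_range_succ, miura]; ring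

theorem column_ne (i : ℕ) (a : ℂ) : column i + MvPolynomial.C a ≠ 0 := by
  intro h
  have := congrArg (pderiv (0, (i : ℤ))) h
  simp [column] at this

theorem pderiv_zero_prod (k : ℕ) :
    pderiv ((0 : ℤ), (0 : ℤ)) (∏ i ∈ range k, (column (i + 1) - 1) * (column (i + 1) + 1)) = 0 := by
  have hcol (i : ℕ) : pderiv ((0 : ℤ), (0 : ℤ)) (column (i + 1)) = 0 :=
    MvPolynomial.pderiv_X_of_ne (by simp; omega)
  induction k with
  | zero => simp
  | succ k ih =>
    rw [prod_range_succ, MvPolynomial.pderiv_mul, ih, MvPolynomial.pderiv_mul, map_sub, map_add,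
      hcol, MvPolynomial.pderiv_one]
    simp

/-- Only the monomial in the Miura variables that contains all of them contributes to the mixed
derivative in the two outermost variables of the density. -/
theorem pderiv_pderiv_latticeDensity (k : ℕ) :
    pderiv (0, ((k + 1 : ℕ) : ℤ)) (pderiv (0, 0) (latticeDensity (k + 1))) =
      (k + 1) * ∏ i ∈ range k, (column (i + 1) - 1) * (column (i + 1) + 1) := by
  set w' : ℕ → MvPolynomial (ℤ × ℤ) ℂ := Function.update (miura column) k 0 with hw'
  set M := ∏ i ∈ range k, (column (i + 1) - 1) * (column (i + 1) + 1) with hM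
  have hrest : density (k + 1) w' ∈ columnSubring (k + 1) := by
    refine density_mem _ _ _ fun i hi => ?_
    rcases eq_or_ne i k with rfl | hik
    · simp [hw']
    · rw [hw', Function.update_of_ne hik]
      exact miura_column_mem (by omega)
  have hsplit := density_succ_sub k (miura column) w' fun i hi => by
    rw [hw', Function.update_of_ne hi.ne]
  have hPM : (∏ i ∈ range k, miura column i) * (miura column k - w' k) =
      (column 0 + 1) * M * (column (k + 1) - 1) := by
    rw [hM, ← prod_miura, prod_range_succ, hw', Function.update_self, sub_zero]
  have hP : latticeDensity (k + 1) =
      (column 0 + 1) * (M * ((k : MvPolynomial (ℤ × ℤ) ℂ) + 1)) * (column (k + 1) - 1) +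
        density (k + 1) w' := by
    rw [hPM] at hsplit
    rw [latticeDensity]
    linear_combination hsplit
  have hMmem : M * ((k : MvPolynomial (ℤ × ℤ) ℂ) + 1) ∈ columnSubring (k + 1) :=
    Subring.mul_mem _ (Subring.prod_mem _ fun i hi => by
      have hi := Finset.mem_range.1 hi
      exact Subring.mul_mem _ (Subring.sub_mem _ (column_mem (by omega)) (Subring.one_mem _))
        (Subring.add_mem _ (column_mem (by omega)) (Subring.one_mem _)))
      (by exact_mod_cast natCast_mem (columnSubring (k + 1)) (k + 1))
  have hd0 : pderiv ((0 : ℤ), ((k + 1 : ℕ) : ℤ)) (M * ((k : MvPolynomial (ℤ × ℤ) ℂ) + 1)) = 0 :=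
    pderiv_eq_zero_of_mem hMmem
  have hM0 : pderiv ((0 : ℤ), (0 : ℤ)) (M * ((k : MvPolynomial (ℤ × ℤ) ℂ) + 1)) = 0 := by
    rw [MvPolynomial.pderiv_mul, hM, pderiv_zero_prod, map_add, Derivation.map_natCast,
      MvPolynomial.pderiv_one]
    simp
  rw [hP, pderiv_comm, map_add, pderiv_eq_zero_of_mem hrest, add_zero]
  have h1 : pderiv ((0 : ℤ), ((k + 1 : ℕ) : ℤ)) (column 0) = 0 :=
    MvPolynomial.pderiv_X_of_ne (by simp; omega)
  have h2 : pderiv ((0 : ℤ), ((k + 1 : ℕ) : ℤ)) (column (k + 1)) = 1 :=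
    MvPolynomial.pderiv_X_self _
  have h3 : pderiv ((0 : ℤ), (0 : ℤ)) (column 0) = 1 := by
    simp [column]
  rw [MvPolynomial.pderiv_mul, MvPolynomial.pderiv_mul, hd0, map_add, map_add, map_sub, h1, h2,
    MvPolynomial.pderiv_one]
  simp only [zero_add, zero_mul, mul_zero, sub_zero, mul_one, map_zero]
  rw [MvPolynomial.pderiv_mul, hM0, map_add, h3, MvPolynomial.pderiv_one]
  ring

theorem pderiv_pderiv_latticeDensity_ne_zero {k : ℕ} (hk : 1 ≤ k) :
    pderiv (0, (k : ℤ)) (pderiv (0, 0) (latticeDensity k)) ≠ 0 := by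
  obtain ⟨k, rfl⟩ := Nat.exists_eq_add_of_le' hk
  rw [pderiv_pderiv_latticeDensity]
  refine mul_ne_zero (by exact_mod_cast Nat.succ_ne_zero k)
    (prod_ne_zero_iff.2 fun i _ => mul_ne_zero ?_ ?_)
  · simpa [sub_eq_add_neg] using column_ne (i + 1) (-1)
  · simpa using column_ne (i + 1) 1

theorem hasOrder_powMul {β : ℂ} (hβ : β ≠ 0) {k : ℕ} (hk : 1 ≤ k) :
    HasOrder (powMul β k (latticeDensity k)) k := by
  refine ⟨k, 0, by exact_mod_cast hk, by simp, fun n m => ?_⟩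
  have hc : β ^ (n * (k : ℤ)) ≠ 0 := zpow_ne_zero _ hβ
  constructor
  · intro ij hij
    refine latticeDensity_dependsOnColumn k ij ?_
    rwa [powMul, MvPolynomial.vars_C_mul _ hc] at hij
  · rw [powMul, MvPolynomial.pderiv_C_mul, MvPolynomial.pderiv_C_mul]
    exact mul_ne_zero (MvPolynomial.C_ne_zero.2 hc) (pderiv_pderiv_latticeDensity_ne_zero hk)

theorem value_powMul (β : ℂ) (k : ℕ) (F : MvPolynomial (ℤ × ℤ) ℂ) (u : ℤ → ℤ → ℂ) (n m : ℤ) :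
    (powMul β k F).value u n m = β ^ (n * (k : ℤ)) *
      MvPolynomial.eval (fun ij : ℤ × ℤ => u (n + ij.1) (m + ij.2)) F := by
  simp [LatticePoly.value, powMul]

theorem eval_latticeDensity (k : ℕ) (u : ℤ → ℤ → ℂ) (n m : ℤ) :
    MvPolynomial.eval (fun ij : ℤ × ℤ => u (n + ij.1) (m + ij.2)) (latticeDensity k) =
      density k (miura fun j => u n (m + j)) := by
  rw [latticeDensity, map_density]
  congr 1
  funext i
  simp [miura, column]

theorem eval_latticeFlux (k : ℕ) (u : ℤ → ℤ → ℂ) (n m : ℤ) :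
    MvPolynomial.eval (fun ij : ℤ × ℤ => u (n + ij.1) (m + ij.2)) (latticeFlux k) =
      flux k fun j => u n (m + j) := by
  rw [latticeFlux, map_flux]
  simp [column]

/-- The lattice equation says that the second Miura image of a column is `β` times the first Miura
image of the next column; by homogeneity this multiplies the `k`-th density by `β ^ k`. -/
theorem isConservationLaw_powMul {β : ℂ} (hβ : β ≠ 0) (k : ℕ) :
    IsConservationLaw β (powMul β k (latticeDensity k)) (powMul β k (latticeFlux k)) := by
  intro u hu n m
  have hcol : (miura' fun j : ℕ => u n (m + j)) =
      fun i => β * miura (fun j : ℕ => u (n + 1) (m + j)) i := by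
    funext i
    simpa [miura, miura', add_assoc] using hu n (m + i)
  have hmain := density_miura_sub k fun j : ℕ => u n (m + j)
  have hshift : (fun j : ℕ => u n (m + ((j + 1 : ℕ) : ℤ))) = fun j : ℕ => u n (m + 1 + j) := by
    funext j
    congr 1
    push_cast
    ring
  rw [hcol, density_mul_left, hshift] at hmain
  have hpow : β ^ ((n + 1) * (k : ℤ)) = β ^ (n * (k : ℤ)) * β ^ k := by
    rw [add_mul, one_mul, zpow_add₀ hβ, zpow_natCast]
  rw [value_powMul, value_powMul, value_powMul, value_powMul, eval_latticeDensity,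
    eval_latticeDensity, eval_latticeFlux, eval_latticeFlux, hpow]
  linear_combination β ^ (n * (k : ℤ)) * hmain

theorem powMul_eq_of_pow_eq_one {β : ℂ} {k : ℕ} (h : β ^ k = 1) (F : MvPolynomial (ℤ × ℤ) ℂ) :
    powMul β k F = fun _ _ => F := by
  funext n m
  rw [powMul, mul_comm n, zpow_mul, zpow_natCast, h, one_zpow, map_one, one_mul]

theorem latticeDensity_ne_zero {k : ℕ} (hk : 1 ≤ k) : latticeDensity k ≠ 0 := by
  intro h
  exact pderiv_pderiv_latticeDensity_ne_zero hk (by simp [h])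

/-- A factor `β ^ (n k)` in front of a nonzero polynomial is constant in `n` exactly if
`β ^ k = 1`. -/
theorem pow_eq_one_of_isAutonomous {β : ℂ} {k : ℕ} {F : MvPolynomial (ℤ × ℤ) ℂ} (hF : F ≠ 0)
    (h : (powMul β k F).IsAutonomous) : β ^ k = 1 := by
  have h1 := mul_right_cancel₀ hF (h 1 0 0 0)
  simpa using MvPolynomial.C_injective _ _ h1

end VolterraDensity

open VolterraDensity in
theorem mainTheorem5 :
    ∃ P Q : ℕ → MvPolynomial (ℤ × ℤ) ℂ,
      -- the general hierarchy, for an arbitrary nonzero coefficient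
      (∀ k : ℕ, 1 ≤ k →
        DependsOnColumn (P k) 0 k ∧ DependsOnColumn (Q k) 0 ((k : ℤ) - 1) ∧
        ∀ β : ℂ, β ≠ 0 →
          IsConservationLaw β (powMul β k (P k)) (powMul β k (Q k)) ∧
          HasOrder (powMul β k (P k)) k) ∧
      -- its autonomous members for a primitive root of unity
      ∀ N : ℕ, 2 ≤ N → ∀ β : ℂ, IsPrimitiveRoot β N →
        (∀ k : ℕ, 1 ≤ k →
          ((powMul β k (P k)).IsAutonomous ∧ (powMul β k (Q k)).IsAutonomous ↔ N ∣ k)) ∧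
        (∀ κ : ℕ, 1 ≤ κ →
          IsConservationLaw β (fun _ _ => P (κ * N)) (fun _ _ => Q (κ * N)) ∧
          HasOrder (fun _ _ => P (κ * N)) (κ * N)) ∧
        {k : ℕ | N ∣ k ∧ ∃ p q : LatticePoly, p.IsAutonomous ∧ q.IsAutonomous ∧
          IsConservationLaw β p q ∧ HasOrder p k}.Infinite := by
  refine ⟨latticeDensity, latticeFlux, fun k hk => ⟨latticeDensity_dependsOnColumn k,
    latticeFlux_dependsOnColumn k, fun β hβ => ⟨isConservationLaw_powMul hβ k,
      hasOrder_powMul hβ hk⟩⟩, fun N hN β hβN => ?_⟩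
  have hβ : β ≠ 0 := hβN.ne_zero (by omega)
  have hpow (κ : ℕ) : β ^ (κ * N) = 1 := (hβN.pow_eq_one_iff_dvd _).2 (Nat.dvd_mul_left N κ)
  have hlaw (κ : ℕ) (hκ : 1 ≤ κ) :
      IsConservationLaw β (fun _ _ => latticeDensity (κ * N)) (fun _ _ => latticeFlux (κ * N)) ∧
        HasOrder (fun _ _ => latticeDensity (κ * N)) (κ * N) := by
    rw [← powMul_eq_of_pow_eq_one (hpow κ), ← powMul_eq_of_pow_eq_one (hpow κ)]
    exact ⟨isConservationLaw_powMul hβ _, hasOrder_powMul hβ (Nat.mul_pos hκ (by omega))⟩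
  refine ⟨fun k hk => ⟨fun h => (hβN.pow_eq_one_iff_dvd k).1
    (pow_eq_one_of_isAutonomous (latticeDensity_ne_zero hk) h.1), fun h => ?_⟩, hlaw, ?_⟩
  · have h1 := (hβN.pow_eq_one_iff_dvd k).2 h
    rw [powMul_eq_of_pow_eq_one h1, powMul_eq_of_pow_eq_one h1]
    exact ⟨fun _ _ _ _ => rfl, fun _ _ _ _ => rfl⟩
  · refine Set.infinite_of_injective_forall_mem (f := fun κ : ℕ => (κ + 1) * N) ?_ fun κ => ?_
    · intro a b hab
      exact Nat.succ_injective (Nat.eq_of_mul_eq_mul_right (by omega) hab)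
    · exact ⟨Nat.dvd_mul_left N _, _, _, fun _ _ _ _ => rfl, fun _ _ _ _ => rfl,
        hlaw (κ + 1) (by omega)⟩
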